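/- Let $n\ge 3$ and let $h:\mathbb R^n\to[0,\infty)$ be continuous with $h\in L^1(\mathbb R^n)\cap L^\infty(\mathbb R^n)$. Equip the real Sobolev space $H^1(\mathbb R^n)$ with the inner product $(u,v)_{H^1}=\int_{\mathbb R^n}(\nabla u\cdot\nabla v+uv)\,dx$ and the norm $\|u\|=(u,u)_{H^1}^{1/2}$. For $u\in H^1(\mathbb R^n)$ let $S(u)=w\in H^1(\mathbb R^n)$ be the unique weak solution of $-\Delta w+w=hu$, i.e. $(w,\phi)_{H^1}=\int_{\mathbb R^n} h\,u\,\phi\,dx$ for all $\phi\in H^1(\mathbb R^n)$. For $\mu\in\mathbb R$ let $N_\mu\subset H^1(\mathbb R^n)$ be the space of weak solutions of $-\Delta u+u=\mu h u$; $\mu$ is an eigenvalue if $N_\mu\ne\{0\}$. Let $\lambda_1<\lambda_2<\cdots$ be the distinct eigenvalues in increasing order, so that $\lambda_j$ is the eigenvalue for which exactly $j-1$ eigenvalues are smaller. Let $k\ge 1$, let $\lambda_k$ be the $k$-th eigenvalue, put $L=I-\lambda_k S$ on $H^1(\mathbb R^n)$, and let $X_+=N_{\lambda_{k+1}}\oplus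 N_{\lambda_{k+2}}\oplus\cdots$ be the closed linear span in $H^1(\mathbb R^n)$ of the spaces $N_{\lambda_j}$, $j>k$. Then $L$ is positive definite on $X_+$: there exists $\alpha>0$ such that $(Lu,u)_{H^1}\ge\alpha\|u\|^2$ for all $u\in X_+$. Moreover, with $\lambda_{k+1}$ the $(k+1)$-th eigenvalue, $\alpha=1-\lambda_k/\lambda_{k+1}>0$ has this property, i.e. $(Lu,u)_{H^1}\ge\left(1-\frac{\lambda_k}{\lambda_{k+1}}\right)\|u\|^2$ for all $u\in X_+$. -/

import Mathlib

open MeasureTheory Set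
open scoped ENNReal ContDiff

noncomputable section

namespace Resonance

/-- The Euclidean space `ℝⁿ`. -/
abbrev Rn (n : ℕ) : Type := EuclideanSpace ℝ (Fin n)

/-- The partial derivative `∂φ/∂xᵢ` at the point `x`. -/
def partialDeriv {n : ℕ} (φ : Rn n → ℝ) (i : Fin n) (x : Rn n) : ℝ :=
  fderiv ℝ φ x (EuclideanSpace.single i 1)

/-- `g` is the weak gradient of `u`: `∫ u ∂ᵢφ = -∫ gᵢ φ` for all `φ ∈ C_c^∞(ℝⁿ)` and all `i`. -/
def IsWeakGradient {n : ℕ} (u : Rn n → ℝ) (g : Rn n → Rn n) : Prop :=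
  ∀ φ : Rn n → ℝ, ContDiff ℝ ∞ φ → HasCompactSupport φ → ∀ i : Fin n,
    ∫ x, u x * partialDeriv φ i x = - ∫ x, g x i * φ x

/-- The Hilbert space `L²(ℝⁿ) × L²(ℝⁿ; ℝⁿ)` with `‖(u, g)‖² = ‖u‖² + ‖g‖²`. -/
abbrev L2Pair (n : ℕ) : Type :=
  WithLp 2 (Lp ℝ 2 (volume : Measure (Rn n)) × Lp (Rn n) 2 (volume : Measure (Rn n)))

lemma memLp_partialDeriv {n : ℕ} {φ : Rn n → ℝ} (hφ : ContDiff ℝ ∞ φ)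
    (hs : HasCompactSupport φ) (i : Fin n) :
    MemLp (partialDeriv φ i) 2 (volume : Measure (Rn n)) := by
  have hc : Continuous (partialDeriv φ i) :=
    (hφ.continuous_fderiv (by simp)).clm_apply continuous_const
  exact hc.memLp_of_hasCompactSupport (hs.fderiv_apply (𝕜 := ℝ) _)

lemma memLp_testVector {n : ℕ} {φ : Rn n → ℝ} (hφ : ContDiff ℝ ∞ φ)
    (hs : HasCompactSupport φ) (i : Fin n) :
    MemLp (fun x => φ x • (EuclideanSpace.single i 1 : Rn n)) 2 (volume : Measure (Rn n)) :=
  (hφ.continuous.smul continuous_const).memLp_of_hasCompactSupport hs.smul_right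

/-- On `L²` pairs the weak gradient identity is an identity of `L²` inner products. -/
lemma isWeakGradient_iff {n : ℕ} (p : L2Pair n) :
    IsWeakGradient (p.fst : Rn n → ℝ) (p.snd : Rn n → Rn n) ↔
      ∀ (φ : Rn n → ℝ) (hφ : ContDiff ℝ ∞ φ) (hs : HasCompactSupport φ) (i : Fin n),
        inner ℝ ((memLp_partialDeriv hφ hs i).toLp _) p.fst =
          - inner ℝ ((memLp_testVector hφ hs i).toLp _) p.snd := by
  refine forall_congr' fun φ => forall_congr' fun hφ => forall_congr' fun hs =>
    forall_congr' fun i => ?_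
  have h1 : inner ℝ ((memLp_partialDeriv hφ hs i).toLp _) p.fst =
      ∫ x, (p.fst : Rn n → ℝ) x * partialDeriv φ i x := by
    rw [L2.inner_def]
    refine integral_congr_ae ?_
    filter_upwards [(memLp_partialDeriv hφ hs i).coeFn_toLp] with x hx
    rw [hx]; simp
  have h2 : inner ℝ ((memLp_testVector hφ hs i).toLp _) p.snd =
      ∫ x, (p.snd : Rn n → Rn n) x i * φ x := by
    rw [L2.inner_def]
    refine integral_congr_ae ?_
    filter_upwards [(memLp_testVector hφ hs i).coeFn_toLp] with x hx
    rw [hx, real_inner_smul_left, EuclideanSpace.inner_single_left]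
    simp [mul_comm]
  rw [h1, h2]

/-- The Sobolev space `H¹(ℝⁿ)`, each function being taken together with its (unique) weak
gradient: the pairs `(u, ∇u)` with `u ∈ L²` and `∇u ∈ L²`. The inherited inner product is
`(u, v) = ∫ (∇u · ∇v + u v)`. -/
def sobolev (n : ℕ) : Submodule ℝ (L2Pair n) where
  carrier := {p | IsWeakGradient (p.fst : Rn n → ℝ) (p.snd : Rn n → Rn n)}
  zero_mem' := by
    rw [mem_ofPred_eq, isWeakGradient_iff]
    intro φ hφ hs i
    simp
  add_mem' := by
    intro p q hp hq
    rw [mem_ofPred_eq, isWeakGradient_iff] at *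
    intro φ hφ hs i
    rw [WithLp.add_fst, WithLp.add_snd, inner_add_right, inner_add_right,
      hp φ hφ hs i, hq φ hφ hs i]
    ring
  smul_mem' := by
    intro c p hp
    rw [mem_ofPred_eq, isWeakGradient_iff] at *
    intro φ hφ hs i
    rw [WithLp.smul_fst, WithLp.smul_snd, inner_smul_right, inner_smul_right, hp φ hφ hs i]
    ring

/-- `H¹(ℝⁿ)` as a type. -/
abbrev H1 (n : ℕ) : Type := sobolev n

lemma isClosed_sobolev (n : ℕ) : IsClosed (sobolev n : Set (L2Pair n)) := by
  have : (sobolev n : Set (L2Pair n)) =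
      ⋂ (φ : Rn n → ℝ) (hφ : ContDiff ℝ ∞ φ) (hs : HasCompactSupport φ) (i : Fin n),
        {p : L2Pair n | inner ℝ ((memLp_partialDeriv hφ hs i).toLp _) p.fst =
          - inner ℝ ((memLp_testVector hφ hs i).toLp _) p.snd} := by
    ext p
    simp only [mem_iInter, mem_ofPred_eq]
    exact isWeakGradient_iff p
  rw [this]
  refine isClosed_iInter fun φ => isClosed_iInter fun hφ => isClosed_iInter fun hs =>
    isClosed_iInter fun i => isClosed_eq ?_ ?_
  · exact continuous_const.inner (WithLp.continuous_fst _ _ _)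
  · exact (continuous_const.inner (WithLp.continuous_snd _ _ _)).neg

instance instCompleteSpaceH1 (n : ℕ) : CompleteSpace (H1 n) :=
  (isClosed_sobolev n).completeSpace_coe

/-- The function underlying an element of `H¹(ℝⁿ)`. -/
def H1.fn {n : ℕ} (u : H1 n) : Lp ℝ 2 (volume : Measure (Rn n)) := u.1.fst

/-- The weak gradient of an element of `H¹(ℝⁿ)`. -/
def H1.grad {n : ℕ} (u : H1 n) : Lp (Rn n) 2 (volume : Measure (Rn n)) := u.1.snd

lemma H1.inner_eq {n : ℕ} (u v : H1 n) :
    inner ℝ u v = (∫ x, inner ℝ (u.grad x) (v.grad x)) + ∫ x, u.fn x * v.fn x := by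
  rw [Submodule.coe_inner, WithLp.prod_inner_apply, L2.inner_def, L2.inner_def, add_comm]
  congr 1
  refine integral_congr_ae (Filter.Eventually.of_forall fun x => ?_)
  simp [H1.fn, mul_comm]

/-- `w ∈ H¹(ℝⁿ)` is a weak solution of `-Δw + w = f`:
`∫ ∇w · ∇φ + ∫ w φ = ∫ f φ` for all `φ ∈ H¹(ℝⁿ)`. -/
def IsWeakSolution {n : ℕ} (w : H1 n) (f : Rn n → ℝ) : Prop :=
  ∀ φ : H1 n, (∫ x, inner ℝ (w.grad x) (φ.grad x)) + (∫ x, w.fn x * φ.fn x) =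
    ∫ x, f x * φ.fn x

/-- The inclusion `H¹(ℝⁿ) → L²(ℝⁿ)`. -/
def inclL2 (n : ℕ) : H1 n →L[ℝ] Lp ℝ 2 (volume : Measure (Rn n)) :=
  (WithLp.fstL 2 ℝ (Lp ℝ 2 (volume : Measure (Rn n)))
    (Lp (Rn n) 2 (volume : Measure (Rn n)))).comp (sobolev n).subtypeL

/-- Multiplication by `h ∈ L^∞(ℝⁿ)` on `L²(ℝⁿ)`. -/
def mulL2 {n : ℕ} {h : Rn n → ℝ} (hb : MemLp h ∞ (volume : Measure (Rn n))) :
    Lp ℝ 2 (volume : Measure (Rn n)) →L[ℝ] Lp ℝ 2 (volume : Measure (Rn n)) :=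
  (ContinuousLinearMap.mul ℝ ℝ).holderL (volume : Measure (Rn n)) ∞ 2 2 hb.toLp

/-- The solution operator `S : H¹(ℝⁿ) → H¹(ℝⁿ)`: `S u` is the unique weak solution `w` of
`-Δw + w = h u` (see `isWeakSolution_iff`). -/
def solOp {n : ℕ} {h : Rn n → ℝ} (hb : MemLp h ∞ (volume : Measure (Rn n))) :
    H1 n →L[ℝ] H1 n :=
  (ContinuousLinearMap.adjoint (inclL2 n)).comp ((mulL2 hb).comp (inclL2 n))

lemma inner_solOp {n : ℕ} {h : Rn n → ℝ} (hb : MemLp h ∞ (volume : Measure (Rn n)))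
    (u φ : H1 n) : inner ℝ (solOp hb u) φ = ∫ x, h x * u.fn x * φ.fn x := by
  rw [solOp, ContinuousLinearMap.comp_apply, ContinuousLinearMap.adjoint_inner_left,
    L2.inner_def]
  refine integral_congr_ae ?_
  filter_upwards [(ContinuousLinearMap.mul ℝ ℝ).coeFn_holder (r := 2) hb.toLp (inclL2 n u),
    hb.coeFn_toLp] with x hx hx'
  have : (mulL2 hb (inclL2 n u) : Rn n → ℝ) x = h x * u.fn x := by
    refine hx.trans ?_
    rw [hx']; rfl
  rw [ContinuousLinearMap.comp_apply, this]
  simp [inclL2, H1.fn, mul_comm]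

/-- `w = c S u` holds exactly when `w` is a weak solution of `-Δw + w = c h u`. -/
lemma isWeakSolution_iff {n : ℕ} {h : Rn n → ℝ} (hb : MemLp h ∞ (volume : Measure (Rn n)))
    (c : ℝ) (w u : H1 n) :
    IsWeakSolution w (fun x => c * (h x * u.fn x)) ↔ w = c • solOp hb u := by
  have key : ∀ φ : H1 n, ∫ x, c * (h x * u.fn x) * φ.fn x = inner ℝ (c • solOp hb u) φ := by
    intro φ
    rw [real_inner_smul_left (F := H1 n), inner_solOp, ← integral_const_mul]
    simp only [mul_assoc]
  constructor
  · intro hw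
    refine ext_inner_right ℝ fun φ => ?_
    rw [H1.inner_eq, hw φ, key φ]
  · intro hw φ
    rw [← H1.inner_eq, key φ, ← hw]

/-- The space `N_μ` of the weak solutions `u ∈ H¹(ℝⁿ)` of `-Δu + u = μ h u`. -/
def eigenspace {n : ℕ} {h : Rn n → ℝ} (hb : MemLp h ∞ (volume : Measure (Rn n))) (μ : ℝ) :
    Submodule ℝ (H1 n) where
  carrier := {u | IsWeakSolution u (fun x => μ * (h x * u.fn x))}
  zero_mem' := (isWeakSolution_iff hb μ 0 0).2 (by simp)
  add_mem' := by
    intro u v hu hv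
    refine (isWeakSolution_iff hb μ _ _).2 ?_
    rw [map_add, smul_add, ← (isWeakSolution_iff hb μ _ _).1 hu,
      ← (isWeakSolution_iff hb μ _ _).1 hv]
  smul_mem' := by
    intro c u hu
    refine (isWeakSolution_iff hb μ _ _).2 ?_
    rw [map_smul, smul_comm, ← (isWeakSolution_iff hb μ _ _).1 hu]

/-- The set of eigenvalues `μ` of `-Δu + u = μ h u`, `u ∈ H¹(ℝⁿ)`. -/
def eigenvalues {n : ℕ} {h : Rn n → ℝ} (hb : MemLp h ∞ (volume : Measure (Rn n))) : Set ℝ :=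
  {μ | ∃ u ∈ eigenspace hb μ, u ≠ 0}

/-- `μ` is the `k`-th eigenvalue `λ_k` (`k = 1, 2, …`) in the increasing enumeration
`λ₁ < λ₂ < …` of the distinct eigenvalues: exactly `k - 1` eigenvalues are smaller. -/
def IsKthEigenvalue {n : ℕ} {h : Rn n → ℝ} (hb : MemLp h ∞ (volume : Measure (Rn n)))
    (k : ℕ) (μ : ℝ) : Prop :=
  μ ∈ eigenvalues hb ∧ {ν ∈ eigenvalues hb | ν < μ}.encard + 1 = k

/-- `X₊ = N_{λ_{k+1}} ⊕ N_{λ_{k+2}} ⊕ …`, the closed linear span in `H¹(ℝⁿ)` of the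
eigenspaces `N_{λ_j}`, `j > k`. -/
def Xplus {n : ℕ} {h : Rn n → ℝ} (hb : MemLp h ∞ (volume : Measure (Rn n))) (k : ℕ) :
    Submodule ℝ (H1 n) :=
  (⨆ (j : ℕ) (_ : k < j) (μ : ℝ) (_ : IsKthEigenvalue hb j μ),
    eigenspace hb μ).topologicalClosure

/-- The operator `L u = u - lam S u` on `H¹(ℝⁿ)`. -/
def opL {n : ℕ} {h : Rn n → ℝ} (hb : MemLp h ∞ (volume : Measure (Rn n))) (lam : ℝ) :
    H1 n →L[ℝ] H1 n :=
  ContinuousLinearMap.id ℝ (H1 n) - lam • solOp hb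

end Resonance

end

/-! A function in `N_μ`, `μ ≠ 0`, is an eigenvector of `S` with eigenvalue `μ⁻¹`. Since `S` is
symmetric for the `H¹` inner product, distinct eigenspaces are orthogonal, so for a finite sum `u =
∑ uⱼ` of eigenvectors with all `μⱼ ≥ m > 0` one gets `(Su, u) = ∑ μⱼ⁻¹ ‖uⱼ‖² ≤ m⁻¹ ‖u‖²`. Both sides
are continuous in `u`, so the bound passes to the closed span, and `(Lu, u) ≥ (1 - λ_k / m) ‖u‖²`
follows. Neither compactness of `S` nor completeness of its eigenvectors enters: the constant is
positive as soon as some `m > λ_k` bounds the later eigenvalues from below. -/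

/-- The quadratic form of a symmetric operator is bounded by `c‖u‖²` on the closed linear span of
the eigenspaces whose eigenvalues are at most `c`. -/
lemma LinearMap.IsSymmetric.inner_le_of_mem_closure_iSup_eigenspace {E : Type*}
    [NormedAddCommGroup E] [InnerProductSpace ℝ E] {T : E →L[ℝ] E}
    (hT : (T : E →ₗ[ℝ] E).IsSymmetric) {c : ℝ} {u : E}
    (hu : u ∈ (⨆ a : Iic c,
      Module.End.eigenspace (T : E →ₗ[ℝ] E) a.1).topologicalClosure) :
    inner ℝ (T u) u ≤ c * ‖u‖ ^ 2 := by
  have horth : OrthogonalFamily ℝ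
      (fun a : Iic c => Module.End.eigenspace (T : E →ₗ[ℝ] E) a.1)
      fun a => (Module.End.eigenspace (T : E →ₗ[ℝ] E) a.1).subtypeₗᵢ :=
    hT.orthogonalFamily_eigenspaces.comp Subtype.val_injective
  refine closure_minimal (s := ((⨆ a : Iic c,
      Module.End.eigenspace (T : E →ₗ[ℝ] E) a.1 : Submodule ℝ E) : Set E))
    (t := {v : E | inner ℝ (T v) v ≤ c * ‖v‖ ^ 2}) ?_ ?_ hu
  · intro v hv
    classical
    obtain ⟨f, rfl⟩ := (Submodule.mem_iSup_iff_exists_dfinsupp' _ _).1 hv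
    have hTf : T (f.sum fun _ x => (x : E)) =
        ∑ a ∈ f.support, (((a : ℝ) • f a : Module.End.eigenspace (T : E →ₗ[ℝ] E) a.1) : E) := by
      rw [DFinsupp.sum, map_sum]
      exact Finset.sum_congr rfl fun a _ => Module.End.mem_eigenspace_iff.1 (f a).2
    have h1 := horth.inner_sum (fun a => (a : ℝ) • f a) f f.support
    have h2 := horth.norm_sum f f.support
    simp only [Submodule.coe_subtypeₗᵢ, Submodule.subtype_apply] at h1 h2
    -- Orthogonality removes the cross terms, leaving a comparison summand by summand.
    rw [mem_ofPred_eq, hTf, DFinsupp.sum, h1, h2, Finset.mul_sum]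
    refine Finset.sum_le_sum fun a _ => ?_
    rw [real_inner_smul_left, real_inner_self_eq_norm_sq]
    exact mul_le_mul_of_nonneg_right a.2 (sq_nonneg _)
  · exact isClosed_le (T.continuous.inner continuous_id) (by fun_prop)

namespace Resonance

variable {n : ℕ} {h : Rn n → ℝ} (hb : MemLp h ∞ (volume : Measure (Rn n)))

lemma mem_eigenspace_iff {μ : ℝ} {u : H1 n} : u ∈ eigenspace hb μ ↔ u = μ • solOp hb u :=
  isWeakSolution_iff hb μ u u

lemma isSymmetric_solOp : (solOp hb : H1 n →ₗ[ℝ] H1 n).IsSymmetric := by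
  intro u v
  rw [ContinuousLinearMap.coe_coe, inner_solOp, real_inner_comm, inner_solOp]
  simp only [mul_right_comm]

lemma inner_solOp_self_nonneg (hnonneg : ∀ x, 0 ≤ h x) (u : H1 n) :
    0 ≤ inner ℝ (solOp hb u) u := by
  rw [inner_solOp]
  refine integral_nonneg fun x => ?_
  rw [mul_assoc]
  exact mul_nonneg (hnonneg x) (mul_self_nonneg (u.fn x))

/-- Testing the equation with `u` itself gives `‖u‖² = μ (Su, u)`, where `(Su, u) ≥ 0` because `h ≥
0`. -/
lemma pos_of_mem_eigenvalues (hnonneg : ∀ x, 0 ≤ h x) {μ : ℝ} (hμ : μ ∈ eigenvalues hb) :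
    0 < μ := by
  obtain ⟨u, hu, hu0⟩ := hμ
  have huu : inner ℝ u u = μ * inner ℝ (solOp hb u) u := by
    rw [← real_inner_smul_left (F := H1 n), ← (mem_eigenspace_iff hb).1 hu]
  have hpos : 0 < inner ℝ u u := real_inner_self_pos.2 hu0
  exact pos_of_mul_pos_left (huu ▸ hpos) (inner_solOp_self_nonneg hb hnonneg u)

lemma eigenspace_le_eigenspace_solOp {μ : ℝ} (hμ : μ ≠ 0) :
    eigenspace hb μ ≤ Module.End.eigenspace (solOp hb : H1 n →ₗ[ℝ] H1 n) μ⁻¹ := by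
  intro u hu
  rw [Module.End.mem_eigenspace_iff, ContinuousLinearMap.coe_coe, eq_inv_smul_iff₀ hμ]
  exact ((mem_eigenspace_iff hb).1 hu).symm

variable {hb}

/-- The eigenvalues below `ν` include `μ` and everything below `μ`, hence at least one more. -/
lemma IsKthEigenvalue.index_lt {i j : ℕ} {μ ν : ℝ} (hμ : IsKthEigenvalue hb i μ)
    (hν : IsKthEigenvalue hb j ν) (hlt : μ < ν) : i < j := by
  have hsub : insert μ {ξ ∈ eigenvalues hb | ξ < μ} ⊆ {ξ ∈ eigenvalues hb | ξ < ν} :=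
    insert_subset ⟨hμ.1, hlt⟩ fun ξ hξ => ⟨hξ.1, hξ.2.trans hlt⟩
  have hcard := encard_le_encard hsub
  rw [encard_insert_of_notMem fun hmem => lt_irrefl μ hmem.2, hμ.2] at hcard
  have hle : (i : ℕ∞) + 1 ≤ j := hν.2 ▸ add_le_add_left hcard 1
  exact_mod_cast hle

lemma IsKthEigenvalue.lt_of_index_lt {i j : ℕ} {μ ν : ℝ} (hμ : IsKthEigenvalue hb i μ)
    (hν : IsKthEigenvalue hb j ν) (hij : i < j) : μ < ν := by
  rcases lt_trichotomy μ ν with hlt | rfl | hgt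
  · exact hlt
  · exact absurd (Nat.cast_injective (R := ℕ∞) (hμ.2.symm.trans hν.2)) hij.ne
  · exact absurd (hν.index_lt hμ hgt) hij.asymm

lemma IsKthEigenvalue.le_of_index_le {i j : ℕ} {μ ν : ℝ} (hμ : IsKthEigenvalue hb i μ)
    (hν : IsKthEigenvalue hb j ν) (hij : i ≤ j) : μ ≤ ν :=
  not_lt.1 fun hlt => (hν.index_lt hμ hlt).not_ge hij

/-- A natural number as index already forces finiteness, since `encard` would otherwise be `⊤`; no
spectral theory is needed. -/
lemma IsKthEigenvalue.finite_le {j : ℕ} {μ : ℝ} (hμ : IsKthEigenvalue hb j μ) :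
    {ξ ∈ eigenvalues hb | ξ ≤ μ}.Finite := by
  have hfin : {ξ ∈ eigenvalues hb | ξ < μ}.Finite := by
    rw [← encard_ne_top_iff]
    intro htop
    have := hμ.2
    rw [htop, top_add] at this
    exact ENat.top_ne_natCast j this
  refine (hfin.insert μ).subset fun ξ hξ => ?_
  rcases hξ.2.lt_or_eq with hlt | rfl
  · exact mem_insert_of_mem _ ⟨hξ.1, hlt⟩
  · exact mem_insert _ _

/-- The eigenvalues of index greater than `k` are bounded away from `λ_k`. -/
lemma IsKthEigenvalue.exists_gap {k : ℕ} {lam : ℝ} (hk : IsKthEigenvalue hb k lam) :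
    ∃ m, lam < m ∧ ∀ j μ, k < j → IsKthEigenvalue hb j μ → m ≤ μ := by
  by_cases hex : ∃ j μ, k < j ∧ IsKthEigenvalue hb j μ
  · obtain ⟨j, μ, hj, hμ⟩ := hex
    have hlt := hk.lt_of_index_lt hμ hj
    have hfin : {ξ ∈ eigenvalues hb | lam < ξ ∧ ξ ≤ μ}.Finite :=
      hμ.finite_le.subset fun ξ hξ => ⟨hξ.1, hξ.2.2⟩
    -- The least eigenvalue in `(lam, μ]`, a finite set containing `μ`.
    obtain ⟨m, hm, hmin⟩ := exists_min_image _ id hfin ⟨μ, hμ.1, hlt, le_rfl⟩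
    refine ⟨m, hm.2.1, fun i ν hi hν => ?_⟩
    rcases le_total ν μ with hle | hle
    · exact hmin ν ⟨hν.1, hk.lt_of_index_lt hν hi, hle⟩
    · exact hm.2.2.trans hle
  -- No later eigenvalue exists, so the bound is vacuous and any `m > lam` serves.
  · push Not at hex
    exact ⟨lam + 1, lt_add_one lam, fun j μ hj hμ => absurd hμ (hex j μ hj)⟩

/-- Stated for an arbitrary lower bound `m`, so that it serves both `λ_{k+1}` and the bound from
`exists_gap`, which does not presuppose a next eigenvalue. -/
lemma inner_opL_ge_of_mem_Xplus (hnonneg : ∀ x, 0 ≤ h x) {k : ℕ} {lam m : ℝ} (hlam : 0 ≤ lam)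
    (hm : 0 < m) (hle : ∀ j μ, k < j → IsKthEigenvalue hb j μ → m ≤ μ) {u : H1 n}
    (hu : u ∈ Xplus hb k) :
    (1 - lam / m) * ‖u‖ ^ 2 ≤ inner ℝ (opL hb lam u) u := by
  have hsup : (⨆ (j : ℕ) (_ : k < j) (μ : ℝ) (_ : IsKthEigenvalue hb j μ), eigenspace hb μ) ≤
      ⨆ a : Iic m⁻¹, Module.End.eigenspace (solOp hb : H1 n →ₗ[ℝ] H1 n) a.1 := by
    refine iSup₂_le fun j hj => iSup₂_le fun μ hμ => ?_
    exact (eigenspace_le_eigenspace_solOp hb (pos_of_mem_eigenvalues hb hnonneg hμ.1).ne').trans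
      (le_iSup (fun a : Iic m⁻¹ => Module.End.eigenspace (solOp hb : H1 n →ₗ[ℝ] H1 n) a.1)
        -- Inversion turns `m ≤ μ` into the upper bound `μ⁻¹ ≤ m⁻¹` on eigenvalues of `S`.
        ⟨μ⁻¹, inv_anti₀ hm (hle j μ hj hμ)⟩)
  have hS := (isSymmetric_solOp hb).inner_le_of_mem_closure_iSup_eigenspace
    (Submodule.topologicalClosure_mono hsup hu)
  have hL : inner ℝ (opL hb lam u) u = ‖u‖ ^ 2 - lam * inner ℝ (solOp hb u) u := by
    rw [opL, sub_apply, smul_apply, inner_sub_left,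
      real_inner_smul_left, ContinuousLinearMap.id_apply, real_inner_self_eq_norm_sq]
  have := mul_le_mul_of_nonneg_left hS hlam
  rw [hL, sub_mul, one_mul, div_eq_mul_inv, mul_assoc]
  exact sub_le_sub_left this _

end Resonance

theorem proposition3 (n : ℕ) (hn : 3 ≤ n) (h : Resonance.Rn n → ℝ) (hcont : Continuous h)
    (hnonneg : ∀ x, 0 ≤ h x) (hint : Integrable h volume) (hbdd : MemLp h ∞ volume)
    (k : ℕ) (lamk : ℝ) (hk : Resonance.IsKthEigenvalue hbdd k lamk) :
    (∃ α : ℝ, 0 < α ∧ ∀ u ∈ Resonance.Xplus hbdd k,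
      α * ‖u‖ ^ 2 ≤ inner ℝ (Resonance.opL hbdd lamk u) u) ∧
    ∀ lamk1 : ℝ, Resonance.IsKthEigenvalue hbdd (k + 1) lamk1 →
      0 < 1 - lamk / lamk1 ∧ ∀ u ∈ Resonance.Xplus hbdd k,
        (1 - lamk / lamk1) * ‖u‖ ^ 2 ≤ inner ℝ (Resonance.opL hbdd lamk u) u := by
  have hpos : 0 < lamk := Resonance.pos_of_mem_eigenvalues hbdd hnonneg hk.1
  have hgap : ∀ m, lamk < m → 0 < 1 - lamk / m := fun m hm =>
    sub_pos.2 ((div_lt_one (hpos.trans hm)).2 hm)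
  constructor
  · obtain ⟨m, hm, hle⟩ := hk.exists_gap
    exact ⟨1 - lamk / m, hgap m hm, fun u hu =>
      Resonance.inner_opL_ge_of_mem_Xplus hnonneg hpos.le (hpos.trans hm) hle hu⟩
  · intro lamk1 hk1
    have hlt := hk.lt_of_index_lt hk1 k.lt_succ_self
    exact ⟨hgap lamk1 hlt, fun u hu =>
      Resonance.inner_opL_ge_of_mem_Xplus hnonneg hpos.le (hpos.trans hlt)
        (fun j μ hj hμ => hk1.le_of_index_le hμ hj) hu⟩
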